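/- **Notation.** For $k\in\mathbb N$, $k\ge 1$, put $\delta=2^{-k}$. Let $\mathcal N(\delta^2)=\{(\xi,\xi^2+t):\xi\in[0,1],\,t\in[0,\delta^2]\}\subset\mathbb R^2$. A dyadic interval is a set $[j2^{-l},(j+1)2^{-l}]$ with integers $l\ge 0$, $0\le j<2^l$; if $I$ is such an interval with $2^{-l}\ge\delta$, then $\mathrm{Part}_\delta(I)$ is its partition (up to endpoints) into dyadic intervals of length $\delta$. Let $F:\mathbb R^2\to\mathbb C$ be a function whose Fourier transform $\widehat F$, in the sense of tempered distributions with $\widehat F(\xi)=\int F(x)e^{-2\pi i x\cdot\xi}\,dx$, is a function (both $F$ and $\widehat F$ being locally integrable functions which, for some $N$, are integrable against $(1+|x|)^{-N}$), and for an interval $J$ let $\mathcal P_JF$ be the function with Fourier transform $\widehat F\,\mathbf 1_{J\times\mathbb R}$. For an axis-parallel square $\Delta$ with center $c_\Delta$ and side length $R$, put $$w_\Delta(x)=\Bigl(1+\tfrac{|x-c_\Delta|}{R}\Bigr)^{-200},\qquad \|f\|_{L^q_\#(w_\Delta)}=\Bigl(\frac1{|\Delta|}\int_{\mathbb R^2}|f|^q\,w_\Delta\Bigr)^{1/q}.$$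 **Theorem (ball inflation).** Let $q\ge 2$, $p=2q$, $c_0>0$ and $\varepsilon>0$. There is a constant $C$, depending only on $q$, $c_0$ and $\varepsilon$, such that the following holds. Let $\delta=2^{-k}$ with $k\ge 1$; let $I_1,I_2\subseteq[0,1]$ be dyadic intervals of length at least $\delta$ with $\mathrm{dist}(I_1,I_2)\ge c_0$; let $Q\subset\mathbb R^2$ be any axis-parallel square of side length $\delta^{-2}$, and let $\mathcal Q$ be its partition into $|\mathcal Q|=\delta^{-2}$ squares $\Delta$ of side length $\delta^{-1}$; let $F$ be as above with $\mathrm{supp}(\widehat F)\subseteq\mathcal N(\delta^2)$. Then $$\frac1{|\mathcal Q|}\sum_{\Delta\in\mathcal Q}\Biggl[\prod_{i=1}^2\Bigl(\sum_{J_i\in\mathrm{Part}_\delta(I_i)}\|\mathcal P_{J_i}F\|_{L^q_\#(w_\Delta)}^2\Bigr)^{1/4}\Biggr]^p\le C\,\delta^{-\varepsilon}\Biggl[\prod_{i=1}^2\Bigl(\sum_{J_i\in\mathrm{Part}_\delta(I_i)}\|\mathcal P_{J_i}F\|_{L^q_\#(w_Q)}^2\Bigr)^{1/4}\Biggr]^p.$$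 -/

import Mathlib

open MeasureTheory FourierTransform SchwartzMap

noncomputable section

namespace BallInflation

/-- The Euclidean plane `ℝ²`. -/
abbrev Plane : Type := EuclideanSpace ℝ (Fin 2)

/-! ### Fourier transform and Fourier projections -/

/-- `f` is a locally integrable function of at most polynomial growth in the mean, so that
`φ ↦ ∫ f φ` is an (absolutely convergent) tempered distribution. -/
def IsTempered (f : Plane → ℂ) : Prop :=
  ∃ N : ℕ, Integrable (fun x : Plane => ((1 + ‖x‖) ^ N)⁻¹ • f x)

/-- The Fourier transform of `F`, in the sense of tempered distributions, is the function `Fhat`: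
`∫ F(x) φ̂(x) dx = ∫ Fhat(ξ) φ(ξ) dξ` for all Schwartz functions `φ`, where
`φ̂(x) = ∫ φ(ξ) e^{-2πi x·ξ} dξ`. This determines `Fhat` almost everywhere, and it agrees with the
Fourier integral for `F ∈ L¹` and with the Plancherel transform for `F ∈ L²`. -/
structure HasFourierTransform (F Fhat : Plane → ℂ) : Prop where
  tempered : IsTempered F
  tempered_hat : IsTempered Fhat
  pairing : ∀ φ : 𝓢(Plane, ℂ), ∫ x, F x * 𝓕 (φ : Plane → ℂ) x = ∫ ξ, Fhat ξ * φ ξ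

/-- The Fourier projection `P_J F` onto the strip `J × ℝ`, i.e. the function with Fourier transform
`Fhat · 1_{J × ℝ}`, as a function of `Fhat` (the Fourier transform of `F`). -/
def fourierProj (Fhat : Plane → ℂ) (J : Set ℝ) : Plane → ℂ :=
  𝓕⁻ (Set.indicator {ξ : Plane | ξ 0 ∈ J} Fhat)

/-- The vertical `δ`-neighborhood `{(ξ, ξ² + t) : ξ ∈ [0,1], t ∈ [0,δ]}` of the parabola
over `[0,1]`. -/
def parabolaNhd (δ : ℝ) : Set Plane :=
  {ξ | ξ 0 ∈ Set.Icc (0 : ℝ) 1 ∧ ∃ t ∈ Set.Icc (0 : ℝ) δ, ξ 1 = ξ 0 ^ 2 + t}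

/-! ### Dyadic intervals -/

/-- The dyadic interval `[j 2^{-l}, (j+1) 2^{-l}]`. Two of them of the same length share at most an
endpoint; this is immaterial for the projections `P_J`. -/
def dyadicInterval (l j : ℕ) : Set ℝ :=
  Set.Icc ((j : ℝ) / 2 ^ l) (((j : ℝ) + 1) / 2 ^ l)

/-- `I` is a dyadic subinterval of `[0,1]` of length at least `2^{-k}`. -/
def IsDyadicAtLeast (k : ℕ) (I : Set ℝ) : Prop :=
  ∃ l j : ℕ, l ≤ k ∧ j < 2 ^ l ∧ I = dyadicInterval l j

open Classical in
/-- The partition of `I` into dyadic intervals of length `2^{-k}`: the set of those `j` such that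
`dyadicInterval k j ⊆ I`. -/
def part (k : ℕ) (I : Set ℝ) : Finset ℕ :=
  (Finset.range (2 ^ k)).filter (fun j => dyadicInterval k j ⊆ I)

/-! ### Squares, weights and weighted averages -/

/-- The weight adapted to the square with center `c` and side length `R` in `ℝ²`
(the exponent is `100 n` with `n = 2`). -/
def weight (c : Plane) (R : ℝ) (x : Plane) : ℝ :=
  1 / (1 + ‖x - c‖ / R) ^ 200

/-- The weighted average `‖f‖_{L^q_#(w_Δ)} = (|Δ|⁻¹ ∫ |f|^q w_Δ)^{1/q}`, where `Δ` is the square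
with center `c` and side length `R`, so that `|Δ| = R²`. -/
def avgNorm (q : ℝ) (c : Plane) (R : ℝ) (f : Plane → ℂ) : ℝ :=
  (1 / R ^ 2 * ∫ x, ‖f x‖ ^ q * weight c R x) ^ (1 / q)

/-- When the square with center `c` and side length `R` is cut into `N × N` equal squares of side
length `R / N`, the center of the one in column `m` and row `n` (with `0 ≤ m, n < N`). -/
def subCenter (c : Plane) (R : ℝ) (N m n : ℕ) : Plane :=
  !₂[c 0 - R / 2 + ((m : ℝ) + 1 / 2) * (R / N), c 1 - R / 2 + ((n : ℝ) + 1 / 2) * (R / N)]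

/-- The bilinear `ℓ²(L^q_#(w_Δ))` quantity at frequency scale `2^{-k}`,
`∏_{i=1,2} (∑_{J ∈ Part(I_i)} ‖P_J F‖²_{L^q_#(w_Δ)})^{1/4}`, for the square `Δ` with center `c` and
side length `R`. -/
def bilinear (q : ℝ) (k : ℕ) (I₁ I₂ : Set ℝ) (Fhat : Plane → ℂ) (c : Plane) (R : ℝ) : ℝ :=
  (∑ j ∈ part k I₁, avgNorm q c R (fourierProj Fhat (dyadicInterval k j)) ^ 2) ^ (1 / 4 : ℝ) *
  (∑ j ∈ part k I₂, avgNorm q c R (fourierProj Fhat (dyadicInterval k j)) ^ 2) ^ (1 / 4 : ℝ)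

end BallInflation

end

/-! Since `Fhat` lives near the parabola, its part over `J = [a, a+δ]` lies in a `δ × δ²`
parallelogram tangent at `(a, a²)`. By the uncertainty principle `P_J F` is then essentially
constant in modulus on dual tubes of size `δ⁻¹ × δ⁻²` along the normal `(-2a, 1)`. Precisely, a
Schwartz reproducing formula bounds the weighted `L^q` mass on a `δ⁻¹`-square by `δ` times the mass
on the tube through it, plus a background of relative size `δ` (`exists_lintegral_fourierProj_le`).

Now take one strip over each `I_i`. Separation of the intervals makes the two tube directions
transversal, so for any two points `y`, `z` only boundedly many squares lie both on the tube of `y`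
and on the tube of `z`; with tails and background this is `exists_sum_decay_mul_decay_le`. Summing
over squares under the double integral gives the bilinear estimate for a single pair of strips,
`exists_sum_avgNorm_mul_avgNorm_le`.

The `2q`-th power of the bilinear quantity is an `ℓ^{q/2}` expression in sums over pairs of strips.
As `q/2 ≥ 1`, Minkowski's inequality passes from pairs to sums with the same constant
(`sum_sum_rpow_le_of_le`). No pigeonholing occurs, so the bound holds without any loss in `δ`. -/

noncomputable section

namespace BallInflation

open scoped ENNReal NNReal

/-! ### Reproducing formula for functions with localized spectrum. -/

section Reproducing

variable {V : Type*} [NormedAddCommGroup V] [InnerProductSpace ℝ V] [FiniteDimensional ℝ V]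
  [MeasurableSpace V] [BorelSpace V]

/-- The inverse Fourier transform of an integrable function is continuous. -/
theorem continuous_fourierInv {h : V → ℂ} (hh : Integrable h) : Continuous (𝓕⁻ h) := by
  rw [Real.fourierInv_eq_fourier_comp_neg]
  exact VectorFourier.fourierIntegral_continuous Real.continuous_fourierChar
    (by exact continuous_inner) hh.comp_neg

theorem norm_fourierInv_le_integral_norm (h : V → ℂ) (x : V) : ‖𝓕⁻ h x‖ ≤ ∫ v, ‖h v‖ := by
  rw [Real.fourierInv_eq]
  refine (norm_integral_le_integral_norm _).trans (le_of_eq ?_)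
  simp

/-- If a Schwartz function `𝓕 ψ`, composed with an affine map, equals one on the support of `h`,
then `𝓕⁻ h` is reproduced by convolution with a modulated and rescaled copy of `ψ`. -/
theorem fourierInv_eq_integral_translate {h : V → ℂ} (hh : Integrable h) (ψ : 𝓢(V, ℂ))
    (A B : V →L[ℝ] V) (hAB : ∀ y ξ, inner ℝ (B y) ξ = inner ℝ y (A ξ)) (ξ₀ : V)
    (hψ : ∀ᵐ ξ, h ξ ≠ 0 → 𝓕 (ψ : V → ℂ) (A (ξ - ξ₀)) = 1) (x : V) :
    𝓕⁻ h x = ∫ y, ψ y * Complex.exp (↑(2 * Real.pi * inner ℝ (B y) ξ₀) * Complex.I) *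
      𝓕⁻ h (x - B y) := by
  set G : V → V → ℂ := fun v y =>
    (h v * ψ y) * Complex.exp (↑(2 * Real.pi * (inner ℝ v (x - B y) + inner ℝ (B y) ξ₀)) *
      Complex.I) with hG
  have hint : Integrable (Function.uncurry G) (volume.prod volume) := by
    have h1 : Integrable (fun z : V × V => h z.1 * ψ z.2) (volume.prod volume) :=
      hh.mul_prod ψ.integrable
    refine h1.mul_bdd (c := 1) ?_ ?_
    · apply Continuous.aestronglyMeasurable
      fun_prop
    · refine Filter.Eventually.of_forall fun z => ?_
      rw [Complex.norm_exp_ofReal_mul_I]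
  calc 𝓕⁻ h x = ∫ v, ∫ y, G v y := by
        rw [Real.fourierInv_eq']
        refine integral_congr_ae ?_
        filter_upwards [hψ] with v hv
        by_cases h0 : h v = 0
        · simp [hG, h0]
        -- On the support of `h` a factor equal to one is inserted and expanded as a Fourier
        -- integral; Fubini then puts the `v`-integral inside.
        have e : h v = h v * 𝓕 (ψ : V → ℂ) (A (v - ξ₀)) := by rw [hv h0, mul_one]
        rw [smul_eq_mul, e, Real.fourier_eq', ← integral_const_mul, ← integral_const_mul]
        refine integral_congr_ae (Filter.Eventually.of_forall fun y => ?_)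
        simp only [hG, smul_eq_mul]
        rw [← hAB, inner_sub_right, inner_sub_right, real_inner_comm (B y) v]
        rw [show ∀ a b c d : ℂ, a * (b * (c * d)) = (b * d) * (a * c) from fun a b c d => by ring,
          ← Complex.exp_add]
        congr 2
        push_cast
        ring
    _ = ∫ y, ∫ v, G v y := integral_integral_swap hint
    _ = _ := by
        refine integral_congr_ae (Filter.Eventually.of_forall fun y => ?_)
        simp only [hG]
        rw [Real.fourierInv_eq', ← integral_const_mul]
        refine integral_congr_ae (Filter.Eventually.of_forall fun v => ?_)
        simp only [smul_eq_mul]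
        rw [show ∀ a b c d : ℂ, a * b * (c * d) = (d * a) * (b * c) from fun a b c d => by ring,
          ← Complex.exp_add]
        congr 2
        push_cast
        ring

theorem enorm_fourierInv_le_lintegral_translate {h : V → ℂ} (hh : Integrable h) (ψ : 𝓢(V, ℂ))
    (A B : V →L[ℝ] V) (hAB : ∀ y ξ, inner ℝ (B y) ξ = inner ℝ y (A ξ)) (ξ₀ : V)
    (hψ : ∀ᵐ ξ, h ξ ≠ 0 → 𝓕 (ψ : V → ℂ) (A (ξ - ξ₀)) = 1) (x : V) :
    ‖𝓕⁻ h x‖ₑ ≤ ∫⁻ y, ‖ψ y‖ₑ * ‖𝓕⁻ h (x - B y)‖ₑ := by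
  rw [fourierInv_eq_integral_translate hh ψ A B hAB ξ₀ hψ x]
  refine (enorm_integral_le_lintegral_enorm _).trans (le_of_eq ?_)
  refine lintegral_congr fun y => ?_
  rw [enorm_mul, enorm_mul]
  have : ‖Complex.exp (↑(2 * Real.pi * inner ℝ (B y) ξ₀) * Complex.I)‖ₑ = 1 := by
    rw [← ofReal_norm, Complex.norm_exp_ofReal_mul_I, ENNReal.ofReal_one]
  rw [this, mul_one]

end Reproducing

/-! ### Weighted `L^q` bounds and Schwartz cutoffs. -/

/-- Jensen's inequality for a weighted lower Lebesgue integral. -/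
theorem lintegral_mul_rpow_le {α : Type*} [MeasurableSpace α] {μ : Measure α} {q : ℝ} (hq : 1 < q)
    {w f : α → ℝ≥0∞} (hw : Measurable w) (hf : Measurable f) :
    (∫⁻ y, w y * f y ∂μ) ^ q ≤ (∫⁻ y, w y ∂μ) ^ (q - 1) * ∫⁻ y, w y * f y ^ q ∂μ := by
  have hq0 : 0 < q := by linarith
  have hc : q.HolderConjugate (q / (q - 1)) := Real.HolderConjugate.conjExponent hq
  -- Hölder for `f · 1` with respect to the measure `w μ`; the `q`-th power turns the mass factor
  -- into exponent `q - 1`.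
  have key := ENNReal.lintegral_mul_le_Lp_mul_Lq (μ.withDensity w) hc hf.aemeasurable
    (g := fun _ => 1) aemeasurable_const
  simp only [Pi.mul_apply, mul_one, ENNReal.one_rpow] at key
  rw [lintegral_withDensity_eq_lintegral_mul _ hw hf,
    lintegral_withDensity_eq_lintegral_mul _ hw (hf.pow_const q),
    lintegral_withDensity_eq_lintegral_mul _ hw measurable_const] at key
  simp only [Pi.mul_apply, mul_one] at key
  calc _ ≤ _ := ENNReal.rpow_le_rpow key hq0.le
    _ = _ := by
      rw [ENNReal.mul_rpow_of_nonneg _ _ hq0.le, ← ENNReal.rpow_mul, ← ENNReal.rpow_mul, mul_comm]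
      congr 2
      · field_simp
      · rw [one_div, inv_mul_cancel₀ hq0.ne', ENNReal.rpow_one]

/-- Weighted `L^q` estimate for a function dominated by averages of its own translates. -/
theorem lintegral_rpow_mul_le {V : Type*} [NormedAddCommGroup V] [NormedSpace ℝ V]
    [FiniteDimensional ℝ V] [MeasureSpace V] [BorelSpace V]
    [(volume : Measure V).IsAddHaarMeasure] {q : ℝ} (hq : 1 < q)
    {f w ψ : V → ℝ≥0∞} (hf : Measurable f) (hw : Measurable w) (hψ : Measurable ψ) {B : V → V}
    (hB : Measurable B) (h : ∀ x, f x ≤ ∫⁻ y, ψ y * f (x - B y)) :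
    ∫⁻ x, f x ^ q * w x ≤
      (∫⁻ y, ψ y) ^ (q - 1) * ∫⁻ x, f x ^ q * ∫⁻ y, ψ y * w (x + B y) := by
  have hq0 : 0 < q := by linarith
  calc ∫⁻ x, f x ^ q * w x
      ≤ ∫⁻ x, (∫⁻ y, ψ y) ^ (q - 1) * ∫⁻ y, ψ y * f (x - B y) ^ q * w x := by
        refine lintegral_mono fun x => ?_
        rw [lintegral_mul_const _ (by fun_prop), ← mul_assoc]
        gcongr
        exact (ENNReal.rpow_le_rpow (h x) hq0.le).trans
          (lintegral_mul_rpow_le hq hψ (by fun_prop))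
    _ = (∫⁻ y, ψ y) ^ (q - 1) * ∫⁻ x, ∫⁻ y, ψ y * f (x - B y) ^ q * w x := by
        rw [lintegral_const_mul]
        exact Measurable.lintegral_prod_right (by fun_prop)
    _ = (∫⁻ y, ψ y) ^ (q - 1) * ∫⁻ y, ∫⁻ x, ψ y * f (x - B y) ^ q * w x := by
        rw [lintegral_lintegral_swap]
        exact Measurable.aemeasurable (by fun_prop)
    _ = (∫⁻ y, ψ y) ^ (q - 1) * ∫⁻ y, ∫⁻ x, ψ y * f x ^ q * w (x + B y) := by
        congr 1
        refine lintegral_congr fun y => ?_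
        -- Translation invariance moves the shift from `f` onto the weight.
        rw [← lintegral_add_right_eq_self _ (B y)]
        simp
    _ = (∫⁻ y, ψ y) ^ (q - 1) * ∫⁻ x, ∫⁻ y, ψ y * f x ^ q * w (x + B y) := by
        rw [lintegral_lintegral_swap]
        exact Measurable.aemeasurable (by fun_prop)
    _ = _ := by
        congr 1
        refine lintegral_congr fun x => ?_
        rw [← lintegral_const_mul _ (by fun_prop)]
        refine lintegral_congr fun y => ?_
        ring

/-- A Schwartz function whose Fourier transform equals one on the ball of radius three. -/
theorem exists_schwartz_fourier_eq_one :
    ∃ ψ : 𝓢(Plane, ℂ), ∀ ξ : Plane, ‖ξ‖ ≤ 3 → 𝓕 (ψ : Plane → ℂ) ξ = 1 := by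
  let b : ContDiffBump (0 : Plane) := ⟨3, 4, by norm_num, by norm_num⟩
  have hb : HasCompactSupport (fun x => ((b x : ℝ) : ℂ)) :=
    b.hasCompactSupport.comp_left (g := ((↑) : ℝ → ℂ)) Complex.ofReal_zero
  have hb' : ContDiff ℝ ((⊤ : ℕ∞) : WithTop ℕ∞) (fun x => ((b x : ℝ) : ℂ)) :=
    Complex.ofRealCLM.contDiff.comp b.contDiff
  refine ⟨𝓕⁻ (hb.toSchwartzMap hb'), fun ξ hξ => ?_⟩
  rw [← SchwartzMap.fourier_coe, FourierTransform.fourier_fourierInv_eq]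
  change ((b ξ : ℝ) : ℂ) = 1
  rw [b.one_of_mem_closedBall (by simpa using hξ), Complex.ofReal_one]

theorem exists_schwartz_decay (ψ : 𝓢(Plane, ℂ)) (n : ℕ) :
    ∃ C : ℝ, 0 < C ∧ ∀ y, ‖ψ y‖ ≤ C / (1 + ‖y‖) ^ n := by
  have h := SchwartzMap.one_add_le_sup_seminorm_apply (𝕜 := ℝ) (m := (n, 0)) (k := n) (n := 0)
    le_rfl le_rfl ψ
  simp only [norm_iteratedFDeriv_zero] at h
  refine ⟨_, lt_of_le_of_lt (le_trans (by positivity) (h 0)) (lt_add_one _), fun y => ?_⟩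
  rw [le_div_iff₀ (by positivity), mul_comm]
  exact (h y).trans (lt_add_one _).le

/-! ### Coordinates on the plane -/

theorem Plane.norm_le_abs_add_abs (x : Plane) : ‖x‖ ≤ |x 0| + |x 1| := by
  have h := EuclideanSpace.real_norm_sq_eq x
  rw [Fin.sum_univ_two] at h
  refine abs_le_of_sq_le_sq' ?_ (by positivity) |>.2
  nlinarith [sq_abs (x 0), sq_abs (x 1), mul_nonneg (abs_nonneg (x 0)) (abs_nonneg (x 1))]

theorem Plane.abs_le_norm (x : Plane) (i : Fin 2) : |x i| ≤ ‖x‖ := by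
  simpa using PiLp.norm_apply_le x i

theorem Plane.lintegral_mul {f g : ℝ → ℝ≥0∞} (hf : Measurable f) (hg : Measurable g) :
    ∫⁻ y : Plane, f (y 0) * g (y 1) = (∫⁻ s, f s) * ∫⁻ t, g t := by
  have h1 : MeasurePreserving (fun y : Plane => (y 0, y 1)) volume (volume.prod volume) :=
    (volume_preserving_finTwoArrow ℝ).comp (PiLp.volume_preserving_ofLp (Fin 2))
  rw [← lintegral_prod_mul hf.aemeasurable hg.aemeasurable, ← h1.lintegral_comp (by fun_prop)]

/-! ### Rescaling the strips of the parabola neighborhood -/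

/-- The linear map sending the `δ × δ²` parallelogram with slope `2a` to the unit square. -/
def stripMap (δ a : ℝ) : Plane →L[ℝ] Plane :=
  LinearMap.toContinuousLinearMap
    { toFun := fun ξ => !₂[ξ 0 / δ, (ξ 1 - 2 * a * ξ 0) / δ ^ 2]
      map_add' := fun x y => by ext i; fin_cases i <;> simp <;> ring
      map_smul' := fun r x => by ext i; fin_cases i <;> simp <;> ring }

/-- The transpose of `stripMap`, which sends the unit square to a `δ⁻¹ × δ⁻²` tube. -/
def tubeMap (δ a : ℝ) : Plane →L[ℝ] Plane :=
  LinearMap.toContinuousLinearMap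
    { toFun := fun y => !₂[y 0 / δ - 2 * a * y 1 / δ ^ 2, y 1 / δ ^ 2]
      map_add' := fun x y => by ext i; fin_cases i <;> simp <;> ring
      map_smul' := fun r x => by ext i; fin_cases i <;> simp <;> ring }

theorem stripMap_apply (δ a : ℝ) (ξ : Plane) :
    stripMap δ a ξ = !₂[ξ 0 / δ, (ξ 1 - 2 * a * ξ 0) / δ ^ 2] := rfl

theorem tubeMap_apply (δ a : ℝ) (y : Plane) :
    tubeMap δ a y = !₂[y 0 / δ - 2 * a * y 1 / δ ^ 2, y 1 / δ ^ 2] := rfl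

theorem inner_tubeMap (δ a : ℝ) (y ξ : Plane) :
    inner ℝ (tubeMap δ a y) ξ = inner ℝ y (stripMap δ a ξ) := by
  simp [tubeMap_apply, stripMap_apply, PiLp.inner_apply, Fin.sum_univ_two]
  ring

/-- The height above the tangent line at `(a, a²)` is `(ξ₀ - a)² + t ≤ 2δ²`, so the rescaled
coordinates are at most 1 and 2. Their sum 3 is the radius on which the cutoff equals one. -/
theorem norm_stripMap_le {δ a : ℝ} (hδ : 0 < δ) {ξ : Plane} (h0 : ξ 0 ∈ Set.Icc a (a + δ))
    (hξ : ξ ∈ parabolaNhd (δ ^ 2)) : ‖stripMap δ a (ξ - !₂[a, a ^ 2])‖ ≤ 3 := by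
  obtain ⟨-, t, ⟨ht0, ht1⟩, h1⟩ := hξ
  obtain ⟨ha, hb⟩ := h0
  refine (Plane.norm_le_abs_add_abs _).trans ?_
  simp only [stripMap_apply, PiLp.sub_apply, PiLp.toLp_apply, Matrix.cons_val_zero,
    Matrix.cons_val_one]
  have e1 : |(ξ 0 - a) / δ| ≤ 1 := by
    rw [abs_of_nonneg (div_nonneg (by linarith) hδ.le), div_le_one hδ]
    linarith
  have e2 : |(ξ 1 - a ^ 2 - 2 * a * (ξ 0 - a)) / δ ^ 2| ≤ 2 := by
    have : ξ 1 - a ^ 2 - 2 * a * (ξ 0 - a) = (ξ 0 - a) ^ 2 + t := by rw [h1]; ring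
    rw [this, abs_of_nonneg (by positivity), div_le_iff₀ (by positivity)]
    nlinarith
  linarith

theorem norm_tubeMap_le {δ a : ℝ} (hδ : 0 < δ) (hδ1 : δ ≤ 1) (ha : 0 ≤ a) (ha1 : a ≤ 1)
    (y : Plane) : δ ^ 2 * ‖tubeMap δ a y‖ ≤ 4 * ‖y‖ := by
  have h := Plane.norm_le_abs_add_abs (tubeMap δ a y)
  simp only [tubeMap_apply, PiLp.toLp_apply, Matrix.cons_val_zero, Matrix.cons_val_one] at h
  have h0 := Plane.abs_le_norm y 0
  have h1 := Plane.abs_le_norm y 1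
  have e0 : δ ^ 2 * |y 0 / δ - 2 * a * y 1 / δ ^ 2| ≤ ‖y‖ + 2 * ‖y‖ := by
    rw [← abs_of_pos (by positivity : 0 < δ ^ 2), ← abs_mul, abs_of_pos (by positivity : 0 < δ ^ 2)]
    have : δ ^ 2 * (y 0 / δ - 2 * a * y 1 / δ ^ 2) = δ * y 0 - (2 * a) * y 1 := by field_simp
    rw [this]
    refine (abs_sub _ _).trans ?_
    rw [abs_mul, abs_mul, abs_of_pos hδ, abs_of_nonneg (by positivity : 0 ≤ 2 * a)]
    gcongr
    · nlinarith [abs_nonneg (y 0)]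
    · nlinarith [abs_nonneg (y 1)]
  have e1 : δ ^ 2 * |y 1 / δ ^ 2| ≤ ‖y‖ := by
    rw [abs_div, abs_of_pos (by positivity : 0 < δ ^ 2), mul_div_cancel₀ _ (by positivity)]
    exact h1
  rw [← tubeMap_apply] at h
  have := mul_le_mul_of_nonneg_left h (sq_nonneg δ)
  linarith

/-- The coordinate of `x` across the tube with direction `(-2a, 1)`. -/
def acrossTube (a : ℝ) (x : Plane) : ℝ := x 0 + 2 * a * x 1

/-- The long direction `(-2a, 1)` of the tube is annihilated, so only the short side `δ⁻¹` is seen.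
-/
theorem acrossTube_tubeMap (δ a : ℝ) (y : Plane) : acrossTube a (tubeMap δ a y) = y 0 / δ := by
  simp only [acrossTube, tubeMap_apply, PiLp.toLp_apply, Matrix.cons_val_zero, Matrix.cons_val_one]
  ring

theorem acrossTube_add (a : ℝ) (x y : Plane) :
    acrossTube a (x + y) = acrossTube a x + acrossTube a y := by
  simp only [acrossTube, PiLp.add_apply]; ring

theorem abs_acrossTube_le {a : ℝ} (ha : 0 ≤ a) (ha1 : a ≤ 1) (x : Plane) :
    |acrossTube a x| ≤ 3 * ‖x‖ := by
  have h0 := Plane.abs_le_norm x 0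
  have h1 := Plane.abs_le_norm x 1
  unfold acrossTube
  refine (abs_add_le _ _).trans ?_
  rw [abs_mul, abs_of_nonneg (by positivity : 0 ≤ 2 * a)]
  nlinarith [abs_nonneg (x 1)]

/-! ### Quadratic decay on the line -/

/-- The function `(1 + |t|)⁻²`. -/
def decay (t : ℝ) : ℝ := 1 / (1 + |t|) ^ 2

theorem decay_pos (t : ℝ) : 0 < decay t := by unfold decay; positivity

theorem continuous_decay : Continuous decay := by
  unfold decay
  exact continuous_const.div (by fun_prop) fun t => by positivity

theorem measurable_decay : Measurable decay := continuous_decay.measurable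

theorem decay_le_decay_mul (s t : ℝ) : decay s ≤ decay (s + t) * (1 + |t|) ^ 2 := by
  unfold decay
  rw [div_mul_eq_mul_div, div_le_div_iff₀ (by positivity) (by positivity), one_mul, one_mul,
    ← mul_pow]
  gcongr
  nlinarith [abs_add_le s t, abs_nonneg s, abs_nonneg t]

theorem integrable_decay : Integrable decay := by
  have h := integrable_one_add_norm (E := ℝ) (μ := volume) (r := 2) (by norm_num)
  refine h.congr (Filter.Eventually.of_forall fun t => ?_)
  simp only [decay, Real.norm_eq_abs]
  rw [Real.rpow_neg (by positivity), one_div]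
  norm_num

/-- Source of the gain `δ`: a `δ⁻¹`-square fills only a fraction `δ` of the length of a tube. -/
theorem lintegral_decay_scale {δ : ℝ} (hδ : 0 < δ) (b : ℝ) :
    ∫⁻ t, ENNReal.ofReal (decay (b + t / δ)) = ENNReal.ofReal (δ * ∫ t, decay t) := by
  have e : ∫ t, decay (b + t / δ) = δ * ∫ t, decay t := by
    rw [Measure.integral_comp_div (fun t => decay (b + t)) δ, abs_of_pos hδ,
      integral_add_left_eq_self, smul_eq_mul]
  rw [← e, ofReal_integral_eq_lintegral_ofReal]
  · exact (integrable_decay.comp_add_left b).comp_div hδ.ne'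
  · exact Filter.Eventually.of_forall fun t => (decay_pos _).le

theorem integral_decay_nonneg : 0 ≤ ∫ t, decay t := integral_nonneg fun t => (decay_pos t).le

/-! ### Averages of a weight along a tube -/

theorem weight_nonneg {c : Plane} {R : ℝ} (hR : 0 ≤ R) (x : Plane) : 0 ≤ weight c R x := by
  unfold weight; positivity

theorem continuous_weight (c : Plane) {R : ℝ} (hR : 0 ≤ R) : Continuous (weight c R) := by
  unfold weight
  refine continuous_const.div (by fun_prop) fun t => ?_
  have := div_nonneg (norm_nonneg (t - c)) hR
  positivity

theorem integrable_weight (c : Plane) {R : ℝ} (hR : 0 < R) : Integrable (weight c R) := by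
  have h := integrable_one_add_norm (E := Plane) (μ := volume) (r := 200)
    (by rw [finrank_euclideanSpace_fin]; norm_num)
  refine ((h.comp_smul (R := R⁻¹) (inv_ne_zero hR.ne')).comp_sub_right c).congr
    (Filter.Eventually.of_forall fun x => ?_)
  simp only [weight]
  rw [Real.rpow_neg (by positivity), one_div, norm_smul, norm_inv, Real.norm_eq_abs,
    abs_of_pos hR, inv_mul_eq_div]
  congr 1
  exact_mod_cast Real.rpow_natCast _ 200

theorem weight_le_of_norm_sub_le {c c' : Plane} {R : ℝ} (hR : 0 < R) (h : ‖c - c'‖ ≤ R)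
    (x : Plane) : weight c R x ≤ 2 ^ 200 * weight c' R x := by
  unfold weight
  rw [mul_one_div, div_le_div_iff₀ (by positivity) (by positivity), one_mul, ← mul_pow]
  gcongr
  have h1 : ‖x - c'‖ ≤ ‖x - c‖ + R := by
    calc ‖x - c'‖ = ‖(x - c) + (c - c')‖ := by congr 1; abel
      _ ≤ _ := (norm_add_le _ _).trans (by linarith)
  have h2 : ‖x - c'‖ / R ≤ ‖x - c‖ / R + 1 := by
    rw [div_add_one hR.ne']; gcongr
  have := div_nonneg (norm_nonneg (x - c)) hR.le
  linarith

/-- Here `t` is a distance in units of `δ⁻¹`, and `δ * t` the same distance in units of `δ⁻²`. If `δ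
* t ≤ 1` the coarse weight is bounded below and the fine one gives the product of decays; if `δ * t
≥ 1` the comparison of the two weights gains `δ ^ 200 ≤ δ ^ 2`, the background. -/
theorem one_div_pow_le_decay {δ : ℝ} (hδ : 0 < δ) (hδ1 : δ ≤ 1) {t u v : ℝ} (ht : 0 ≤ t)
    (hu : |u| ≤ 3 * t) (hv : |v| ≤ t) :
    1 / (1 + t) ^ 200 ≤
      9 * 2 ^ 200 * (1 / (1 + δ * t) ^ 200) * (decay u * decay v + δ ^ 2) := by
  rcases le_total (δ * t) 1 with h | h
  · have hd : 1 / (1 + t) ^ 200 ≤ 9 * (decay u * decay v) := by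
      unfold decay
      rw [one_div_mul_one_div, mul_one_div, div_le_div_iff₀ (by positivity) (by positivity), one_mul]
      calc (1 + |u|) ^ 2 * (1 + |v|) ^ 2 ≤ (3 * (1 + t)) ^ 2 * (1 + t) ^ 2 := by
            gcongr
            linarith
        _ = 9 * (1 + t) ^ 4 := by ring
        _ ≤ 9 * (1 + t) ^ 200 := by
            gcongr
            · linarith
            · norm_num
    have hp : 1 ≤ 2 ^ 200 * (1 / (1 + δ * t) ^ 200) := by
      rw [mul_one_div, one_le_div (by positivity)]
      gcongr
      linarith
    have hdd := mul_pos (decay_pos u) (decay_pos v)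
    have hP : (0 : ℝ) ≤ 2 ^ 200 * (1 / (1 + δ * t) ^ 200) := by positivity
    calc _ ≤ 1 * (9 * (decay u * decay v)) := by rw [one_mul]; exact hd
      _ ≤ (2 ^ 200 * (1 / (1 + δ * t) ^ 200)) * (9 * (decay u * decay v + δ ^ 2)) := by
          gcongr
          nlinarith [sq_nonneg δ]
      _ = _ := by
          generalize 1 / (1 + δ * t) ^ 200 = P
          ring
  · have hd : 1 / (1 + t) ^ 200 ≤ 2 ^ 200 * (1 / (1 + δ * t) ^ 200) * δ ^ 2 := by
      rw [mul_one_div, div_mul_eq_mul_div, div_le_div_iff₀ (by positivity) (by positivity), one_mul]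
      calc (1 + δ * t) ^ 200 ≤ (2 * (δ * t)) ^ 200 := by
            gcongr
            linarith
        _ = 2 ^ 200 * δ ^ 200 * t ^ 200 := by rw [mul_pow, mul_pow, mul_assoc]
        _ ≤ 2 ^ 200 * δ ^ 2 * (1 + t) ^ 200 := by
            have : δ ^ 200 ≤ δ ^ 2 := pow_le_pow_of_le_one hδ.le hδ1 (by norm_num)
            gcongr
            linarith
    have hdd := mul_pos (decay_pos u) (decay_pos v)
    have hP : (0 : ℝ) ≤ 2 ^ 200 * (1 / (1 + δ * t) ^ 200) := by positivity
    calc _ ≤ 2 ^ 200 * (1 / (1 + δ * t) ^ 200) * δ ^ 2 := hd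
      _ ≤ 2 ^ 200 * (1 / (1 + δ * t) ^ 200) * (9 * (decay u * decay v + δ ^ 2)) := by
          gcongr
          nlinarith [sq_nonneg δ]
      _ = _ := by
          generalize 1 / (1 + δ * t) ^ 200 = P
          ring

/-- Of the power 206, 200 pays for undoing the shift in the coarse weight; of the other 6, the first
term spends 2 on undoing the shift in the transversal decay and 2 on `decay (y 0)`, the second
spends 4 on decay in both coordinates. The base 8 is `2 * 4`, the 4 coming from `norm_tubeMap_le`.
-/
theorem one_div_pow_mul_weight_le {δ a : ℝ} (hδ : 0 < δ) (hδ1 : δ ≤ 1) (ha : 0 ≤ a) (ha1 : a ≤ 1)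
    (c x y : Plane) :
    1 / (1 + ‖y‖) ^ 206 * weight c δ⁻¹ (x + tubeMap δ a y) ≤
      9 * 8 ^ 200 * weight c (δ⁻¹ ^ 2) x *
        (decay (δ * acrossTube a (x - c)) * (decay (y 0) * decay (δ * (x - c) 1 + y 1 / δ)) +
          δ ^ 2 * (decay (y 0) * decay (y 1))) := by
  set z : Plane := x - c + tubeMap δ a y with hz
  have hw : weight c δ⁻¹ (x + tubeMap δ a y) = 1 / (1 + δ * ‖z‖) ^ 200 := by
    unfold weight
    rw [div_inv_eq_mul, mul_comm δ, hz]
    congr 5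
    abel
  have hu : |δ * acrossTube a z| ≤ 3 * (δ * ‖z‖) := by
    rw [abs_mul, abs_of_pos hδ]
    nlinarith [abs_acrossTube_le ha ha1 z]
  have hv : |δ * z 1| ≤ δ * ‖z‖ := by
    rw [abs_mul, abs_of_pos hδ]
    nlinarith [Plane.abs_le_norm z 1]
  have key := one_div_pow_le_decay hδ hδ1 (by positivity : 0 ≤ δ * ‖z‖) hu hv
  have hz1 : δ * z 1 = δ * (x - c) 1 + y 1 / δ := by
    have : (tubeMap δ a y) 1 = y 1 / δ ^ 2 := rfl
    rw [hz, PiLp.add_apply, this]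
    field_simp
  have huz : δ * acrossTube a z = δ * acrossTube a (x - c) + y 0 := by
    rw [hz, acrossTube_add, acrossTube_tubeMap]
    field_simp
  have hy0 := Plane.abs_le_norm y 0
  have hy1 := Plane.abs_le_norm y 1
  have hN := norm_nonneg y
  have d1 : decay (δ * acrossTube a z) ≤ decay (δ * acrossTube a (x - c)) * (1 + ‖y‖) ^ 2 := by
    rw [huz]
    refine (decay_le_decay_mul _ (-y 0)).trans ?_
    rw [abs_neg, add_neg_cancel_right]
    gcongr
    exact (decay_pos _).le
  have d2 : 1 / (1 + δ * (δ * ‖z‖)) ^ 200 ≤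
      4 ^ 200 * weight c (δ⁻¹ ^ 2) x * (1 + ‖y‖) ^ 200 := by
    unfold weight
    rw [mul_one_div, div_mul_eq_mul_div, div_le_div_iff₀ (by positivity) (by positivity), one_mul,
      ← mul_pow, ← mul_pow]
    gcongr
    have e : ‖x - c‖ ≤ ‖z‖ + ‖tubeMap δ a y‖ := by
      have : x - c = z - tubeMap δ a y := by rw [hz]; abel
      rw [this]
      exact norm_sub_le _ _
    rw [inv_pow, div_inv_eq_mul]
    have e2 : ‖x - c‖ * δ ^ 2 ≤ δ * (δ * ‖z‖) + 4 * ‖y‖ := by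
      have := norm_tubeMap_le hδ hδ1 ha ha1 y
      nlinarith [sq_nonneg δ]
    have : 0 ≤ ‖y‖ * (δ * (δ * ‖z‖)) := by positivity
    have : 0 ≤ δ * (δ * ‖z‖) := by positivity
    nlinarith
  have b0 : ∀ i, 1 / (1 + ‖y‖) ^ 2 ≤ decay (y i) := fun i => by
    unfold decay
    have := Plane.abs_le_norm y i
    gcongr
  rw [hw, ← hz1]
  have hz0 := decay_pos (δ * acrossTube a z)
  set D := decay (δ * acrossTube a (x - c))
  set E := decay (δ * z 1)
  have hD : 0 < D := decay_pos _
  have hE : 0 < E := decay_pos _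
  set W := weight c (δ⁻¹ ^ 2) x
  have hW : 0 ≤ W := weight_nonneg (by positivity) _
  set Y := 1 + ‖y‖ with hY
  have hY1 : 1 ≤ Y := by linarith
  have hd0 := (decay_pos (y 0)).le
  have hd1 := (decay_pos (y 1)).le
  rw [show (8 : ℝ) ^ 200 = 2 ^ 200 * 4 ^ 200 by rw [← mul_pow]; norm_num]
  have hp : (0 : ℝ) ≤ 2 ^ 200 := by positivity
  have hr : (0 : ℝ) ≤ 4 ^ 200 := by positivity
  generalize (2 : ℝ) ^ 200 = p at *
  generalize (4 : ℝ) ^ 200 = r at *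
  clear_value D E W Y
  have hY200 : 0 ≤ Y ^ 200 := by positivity
  calc 1 / Y ^ 206 * (1 / (1 + δ * ‖z‖) ^ 200)
      ≤ 1 / Y ^ 206 * (9 * p * (r * W * Y ^ 200) * (D * Y ^ 2 * E + δ ^ 2)) := by
        refine mul_le_mul_of_nonneg_left (key.trans ?_) (by positivity)
        gcongr
    _ = 9 * (p * r) * W * (D * (1 / Y ^ 2 * (1 / Y ^ 2) * E) +
          δ ^ 2 * (1 / Y ^ 2 * (1 / Y ^ 2 * (1 / Y ^ 2)))) := by
        rw [show Y ^ 206 = Y ^ 200 * Y ^ 6 by rw [← pow_add]]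
        have : Y ^ 200 ≠ 0 := by positivity
        generalize Y ^ 200 = s at *
        field_simp
    _ ≤ 9 * (p * r) * W * (D * (decay (y 0) * 1 * E) +
          δ ^ 2 * (decay (y 0) * (decay (y 1) * 1))) := by
        have h1 : 1 / Y ^ 2 ≤ 1 := by
          rw [div_le_one (by positivity)]; exact one_le_pow₀ hY1
        gcongr
        · exact b0 0
        · exact b0 0
        · exact b0 1
    _ = _ := by ring

/-- Averaging the weight of a `δ⁻¹`-square along a tube of width `δ⁻¹` and length `δ⁻²` yields a
weight of size `δ` that is concentrated on the tube, up to a background of relative size `δ`. -/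
theorem exists_lintegral_weight_tube_le (ψ : 𝓢(Plane, ℂ)) :
    ∃ C : ℝ, 0 < C ∧ ∀ δ a : ℝ, 0 < δ → δ ≤ 1 → 0 ≤ a → a ≤ 1 → ∀ c x : Plane,
      ∫⁻ y, ‖ψ y‖ₑ * ENNReal.ofReal (weight c δ⁻¹ (x + tubeMap δ a y)) ≤
        ENNReal.ofReal (C * δ * weight c (δ⁻¹ ^ 2) x * (decay (δ * acrossTube a (x - c)) + δ)) := by
  obtain ⟨K, hK, hψ⟩ := exists_schwartz_decay ψ 206
  set I := ∫ t, decay t with hI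
  have hI0 : 0 ≤ I := integral_decay_nonneg
  refine ⟨K * (9 * 8 ^ 200) * (I ^ 2 + 1), by positivity, fun δ a hδ hδ1 ha ha1 c x => ?_⟩
  set W := weight c (δ⁻¹ ^ 2) x
  have hW : 0 ≤ W := weight_nonneg (by positivity) _
  set D := decay (δ * acrossTube a (x - c))
  have hD : 0 < D := decay_pos _
  set b := δ * (x - c) 1
  have hm : Measurable fun t => ENNReal.ofReal (decay t) := measurable_decay.ennreal_ofReal
  have hmb : Measurable fun t => ENNReal.ofReal (decay (b + t / δ)) :=
    (measurable_decay.comp (by fun_prop)).ennreal_ofReal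
  have hc0 : Measurable fun y : Plane => ENNReal.ofReal (decay (y 0)) := hm.comp (by fun_prop)
  have hc1 : Measurable fun y : Plane => ENNReal.ofReal (decay (y 1)) := hm.comp (by fun_prop)
  have hcb : Measurable fun y : Plane => ENNReal.ofReal (decay (b + y 1 / δ)) :=
    hmb.comp (g := fun t => ENNReal.ofReal (decay (b + t / δ))) (f := fun y : Plane => y 1)
      (by fun_prop)
  have hI1 : ∫⁻ t, ENNReal.ofReal (decay t) = ENNReal.ofReal I :=
    (ofReal_integral_eq_lintegral_ofReal integrable_decay
      (Filter.Eventually.of_forall fun t => (decay_pos t).le)).symm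
  calc ∫⁻ y, ‖ψ y‖ₑ * ENNReal.ofReal (weight c δ⁻¹ (x + tubeMap δ a y))
      ≤ ∫⁻ y : Plane, ENNReal.ofReal (K * (9 * 8 ^ 200) * W) * (ENNReal.ofReal D *
          (ENNReal.ofReal (decay (y 0)) * ENNReal.ofReal (decay (b + y 1 / δ))) +
          ENNReal.ofReal (δ ^ 2) *
            (ENNReal.ofReal (decay (y 0)) * ENNReal.ofReal (decay (y 1)))) := by
        refine lintegral_mono fun y => ?_
        have h0 := (decay_pos (y 0)).le
        have h1 := (decay_pos (y 1)).le
        have h2 := (decay_pos (b + y 1 / δ)).le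
        rw [← ofReal_norm, ← ENNReal.ofReal_mul (norm_nonneg _), ← ENNReal.ofReal_mul h0,
          ← ENNReal.ofReal_mul h0, ← ENNReal.ofReal_mul hD.le, ← ENNReal.ofReal_mul (by positivity),
          ← ENNReal.ofReal_add (by positivity) (by positivity),
          ← ENNReal.ofReal_mul (by positivity)]
        refine ENNReal.ofReal_le_ofReal ?_
        have hw : 0 ≤ weight c δ⁻¹ (x + tubeMap δ a y) := weight_nonneg (by positivity) _
        calc _ ≤ K / (1 + ‖y‖) ^ 206 * weight c δ⁻¹ (x + tubeMap δ a y) :=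
              mul_le_mul_of_nonneg_right (hψ y) hw
          _ = K * (1 / (1 + ‖y‖) ^ 206 * weight c δ⁻¹ (x + tubeMap δ a y)) := by ring
          _ ≤ K * _ := mul_le_mul_of_nonneg_left
              (one_div_pow_mul_weight_le hδ hδ1 ha ha1 c x y) hK.le
          _ = _ := by ring
    -- The integrals separate: the integral along the tube is `δ * I` in the main term, while the
    -- background already carries `δ ^ 2`. Both are then multiples of the terms of `δ * (D + δ)`.
    _ = ENNReal.ofReal (K * (9 * 8 ^ 200) * W) * (ENNReal.ofReal D *
          (ENNReal.ofReal I * ENNReal.ofReal (δ * I)) +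
          ENNReal.ofReal (δ ^ 2) * (ENNReal.ofReal I * ENNReal.ofReal I)) := by
        rw [lintegral_const_mul _ (by fun_prop), lintegral_add_left (by fun_prop),
          lintegral_const_mul _ (by fun_prop), lintegral_const_mul _ (by fun_prop),
          Plane.lintegral_mul hm hmb, Plane.lintegral_mul hm hm, hI1, lintegral_decay_scale hδ]
    _ = ENNReal.ofReal (K * (9 * 8 ^ 200) * W * (D * (I * (δ * I)) + δ ^ 2 * (I * I))) := by
        rw [← ENNReal.ofReal_mul hI0, ← ENNReal.ofReal_mul hI0, ← ENNReal.ofReal_mul hD.le,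
          ← ENNReal.ofReal_mul (by positivity),
          ← ENNReal.ofReal_add (by positivity) (by positivity),
          ← ENNReal.ofReal_mul (by positivity)]
    _ ≤ _ := by
        refine ENNReal.ofReal_le_ofReal ?_
        have : (0 : ℝ) ≤ K * (9 * 8 ^ 200) * W * (δ * (D + δ)) := by positivity
        generalize (8 : ℝ) ^ 200 = p at *
        nlinarith

/-! ### Counting the squares met by two transversal tubes -/

/-- Rounding `α` to its floor costs a factor at most `(1 + 1)² = 4`, after which the sum is part of
a convergent series over the integers. -/
theorem exists_sum_decay_le :
    ∃ K : ℝ, 0 < K ∧ ∀ (α : ℝ) (N : ℕ), ∑ m ∈ Finset.range N, decay (α - m) ≤ K := by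
  have hs : Summable fun j : ℤ => decay j := by
    have h1 : Summable fun j : ℤ => 1 / (j : ℝ) ^ 2 :=
      Real.summable_one_div_int_pow.mpr one_lt_two
    refine Summable.of_norm_bounded_eventually h1 ?_
    rw [Filter.eventually_cofinite]
    refine (Set.finite_singleton (0 : ℤ)).subset fun j hj => ?_
    by_contra h0
    apply hj
    have hj0 : (0 : ℝ) < |(j : ℝ)| := abs_pos.mpr (Int.cast_ne_zero.mpr h0)
    rw [Real.norm_of_nonneg (decay_pos _).le, decay, ← sq_abs (j : ℝ)]
    gcongr
    linarith
  have hpos : 0 < ∑' j : ℤ, decay j :=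
    hs.tsum_pos (fun j => (decay_pos _).le) 0 (decay_pos _)
  refine ⟨∑' j : ℤ, decay j * 4, by rw [tsum_mul_right]; positivity, fun α N => ?_⟩
  have hle : ∀ m : ℕ, decay (α - m) ≤ decay ((⌊α⌋ - m : ℤ) : ℝ) * 4 := by
    intro m
    have h := decay_le_decay_mul (α - m) (-Int.fract α)
    have e : α - m + -Int.fract α = ((⌊α⌋ - m : ℤ) : ℝ) := by
      push_cast
      linarith [Int.floor_add_fract α]
    rw [e, abs_neg, abs_of_nonneg (Int.fract_nonneg α)] at h
    refine h.trans ?_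
    have hd := (decay_pos ((⌊α⌋ - m : ℤ) : ℝ)).le
    gcongr
    nlinarith [Int.fract_nonneg α, Int.fract_lt_one α]
  have hinj : Set.InjOn (fun m : ℕ => ⌊α⌋ - (m : ℤ)) (Finset.range N) := by
    intro m _ n _ h
    simpa using h
  calc _ ≤ ∑ m ∈ Finset.range N, decay ((⌊α⌋ - m : ℤ) : ℝ) * 4 :=
        Finset.sum_le_sum fun m _ => hle m
    _ = ∑ j ∈ (Finset.range N).image (fun m : ℕ => ⌊α⌋ - (m : ℤ)), decay j * 4 :=
        (Finset.sum_image (f := fun j : ℤ => decay j * 4) hinj).symm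
    _ ≤ _ := (hs.mul_right 4).sum_le_tsum _ fun j _ => mul_nonneg (decay_pos _).le (by norm_num)

/-- The larger of `|s|`, `|t|` is at least `|s - t| / 2`, so its decay factor is at most `4 * decay
(s - t)`. -/
theorem decay_mul_decay_le (s t : ℝ) :
    decay s * decay t ≤ 4 * decay (s - t) * (decay s + decay t) := by
  have key : ∀ u v : ℝ, |v| ≤ |u| → decay u ≤ 4 * decay (u - v) := by
    intro u v h
    unfold decay
    rw [mul_one_div, div_le_div_iff₀ (by positivity) (by positivity), one_mul,
      show (4 : ℝ) = 2 ^ 2 by norm_num, ← mul_pow]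
    gcongr
    linarith [abs_sub u v]
  have hs := decay_pos s
  have ht := decay_pos t
  have hst := decay_pos (s - t)
  rcases le_total |t| |s| with h | h
  · have := key s t h
    nlinarith [mul_pos hst hs]
  · have := key t s h
    have e : decay (t - s) = decay (s - t) := by
      unfold decay; rw [abs_sub_comm]
    rw [e] at this
    nlinarith [mul_pos hst ht]

/-- Over an `N × N` grid of squares, the overlap of two transversal families of tubes of width one,
each with a background of size `δ = 1 / N`, is bounded independently of `N`. -/
theorem exists_sum_decay_mul_decay_le {c₀ : ℝ} (hc₀ : 0 < c₀) :
    ∃ C : ℝ, 0 < C ∧ ∀ (N : ℕ) (δ a b : ℝ), 0 < δ → δ * N = 1 → c₀ ≤ |a - b| → ∀ α β : ℝ,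
      ∑ m ∈ Finset.range N, ∑ n ∈ Finset.range N,
        (decay (α - m - 2 * a * n) + δ) * (decay (β - m - 2 * b * n) + δ) ≤ C := by
  obtain ⟨K, hK, hsum⟩ := exists_sum_decay_le
  set M : ℝ := (1 + 1 / (2 * c₀)) ^ 2 with hM
  have hM0 : 0 < M := by positivity
  refine ⟨4 * (M * K) * (2 * K) + 2 * K + 1, by positivity, fun N δ a b hδ hN hab α β => ?_⟩
  have hd0 : 0 < |a - b| := hc₀.trans_le hab
  have hd : a - b ≠ 0 := abs_pos.mp hd0
  have hsum' : ∀ (α a : ℝ) (n : ℕ), ∑ m ∈ Finset.range N, decay (α - m - 2 * a * n) ≤ K := by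
    intro α a n
    convert hsum (α - 2 * a * n) N using 3
    ring
  -- Subtracting the two tube conditions eliminates `m` and leaves a condition on the row `n` with
  -- step `2 * (a - b)`. Transversality enters here: this step is at least `2 * c₀` in modulus, so
  -- rescaling to unit step costs only `M`.
  have hn : ∀ n : ℕ, decay ((α - β) - 2 * (a - b) * n) ≤
      M * decay ((α - β) / (2 * (a - b)) - n) := by
    intro n
    have e : (α - β) / (2 * (a - b)) - n = ((α - β) - 2 * (a - b) * n) / (2 * (a - b)) := by
      field_simp
    rw [e]
    set z := (α - β) - 2 * (a - b) * n
    have hz := abs_nonneg z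
    unfold decay
    rw [hM, abs_div, abs_mul, abs_two, mul_one_div,
      div_le_div_iff₀ (by positivity) (by positivity), one_mul, ← mul_pow]
    gcongr
    have h1 : |z| / (2 * |a - b|) ≤ |z| / (2 * c₀) := by gcongr
    have h2 : 0 ≤ 1 / (2 * c₀) := by positivity
    calc 1 + |z| / (2 * |a - b|) ≤ 1 + |z| / (2 * c₀) := by linarith
      _ ≤ 1 + |z| / (2 * c₀) + (1 / (2 * c₀) + |z|) := by linarith
      _ = _ := by ring
  have hnsum : ∑ n ∈ Finset.range N, decay ((α - β) - 2 * (a - b) * n) ≤ M * K := by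
    calc _ ≤ ∑ n ∈ Finset.range N, M * decay ((α - β) / (2 * (a - b)) - n) :=
          Finset.sum_le_sum fun n _ => hn n
      _ ≤ _ := by
          rw [← Finset.mul_sum]
          exact mul_le_mul_of_nonneg_left (hsum _ N) hM0.le
  rw [Finset.sum_comm]
  have hrow : ∀ n ∈ Finset.range N, ∑ m ∈ Finset.range N,
      (decay (α - m - 2 * a * n) + δ) * (decay (β - m - 2 * b * n) + δ) ≤
        4 * decay ((α - β) - 2 * (a - b) * n) * (2 * K) + δ * (2 * K) + δ := by
    intro n _
    have hDn := decay_pos ((α - β) - 2 * (a - b) * n)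
    have hpt : ∀ m ∈ Finset.range N,
        (decay (α - m - 2 * a * n) + δ) * (decay (β - m - 2 * b * n) + δ) ≤
        (4 * decay ((α - β) - 2 * (a - b) * n) + δ) *
          (decay (α - m - 2 * a * n) + decay (β - m - 2 * b * n)) + δ ^ 2 := by
      intro m _
      have h := decay_mul_decay_le (α - m - 2 * a * n) (β - m - 2 * b * n)
      have e : α - m - 2 * a * n - (β - m - 2 * b * n) = (α - β) - 2 * (a - b) * n := by ring
      rw [e] at h
      linarith
    calc _ ≤ _ := Finset.sum_le_sum hpt
      _ = (4 * decay ((α - β) - 2 * (a - b) * n) + δ) *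
          (∑ m ∈ Finset.range N, decay (α - m - 2 * a * n) +
            ∑ m ∈ Finset.range N, decay (β - m - 2 * b * n)) + δ * (δ * N) := by
          rw [Finset.sum_add_distrib, ← Finset.mul_sum, Finset.sum_add_distrib, Finset.sum_const,
            Finset.card_range, nsmul_eq_mul]
          ring
      _ ≤ (4 * decay ((α - β) - 2 * (a - b) * n) + δ) * (K + K) + δ * (δ * N) := by
          gcongr
          · exact hsum' α a n
          · exact hsum' β b n
      _ = _ := by rw [hN]; ring
  -- The background contributes at most a multiple of `δ` per row, hence a bounded total because `δ
  -- * N = 1`.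
  calc _ ≤ _ := Finset.sum_le_sum hrow
    _ = 4 * (∑ n ∈ Finset.range N, decay ((α - β) - 2 * (a - b) * n)) * (2 * K) +
          (δ * N) * (2 * K) + δ * N := by
        rw [Finset.sum_add_distrib, Finset.sum_add_distrib, ← Finset.sum_mul, ← Finset.mul_sum,
          Finset.sum_const, Finset.sum_const, Finset.card_range, nsmul_eq_mul, nsmul_eq_mul]
        ring
    _ ≤ _ := by
        rw [hN, one_mul]
        gcongr

/-! ### Two general inequalities -/

/-- Each product of integrals is a double integral, so the sum can be taken inside, where only the
overlap of the kernels at a fixed pair of points matters. -/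
theorem sum_lintegral_mul_lintegral_le {ι α : Type*} [MeasurableSpace α] {μ : Measure α}
    (s : Finset ι) {g₁ g₂ : α → ℝ≥0∞} {φ₁ φ₂ : ι → α → ℝ≥0∞} (hg₁ : Measurable g₁)
    (hg₂ : Measurable g₂) (h₁ : ∀ i, Measurable (φ₁ i)) (h₂ : ∀ i, Measurable (φ₂ i)) {C : ℝ≥0∞}
    (h : ∀ y z, ∑ i ∈ s, φ₁ i y * φ₂ i z ≤ C) :
    ∑ i ∈ s, (∫⁻ y, φ₁ i y * g₁ y ∂μ) * ∫⁻ z, φ₂ i z * g₂ z ∂μ ≤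
      C * (∫⁻ y, g₁ y ∂μ) * ∫⁻ z, g₂ z ∂μ := by
  calc _ = ∑ i ∈ s, ∫⁻ y, ∫⁻ z, φ₁ i y * φ₂ i z * (g₁ y * g₂ z) ∂μ ∂μ := by
        refine Finset.sum_congr rfl fun i _ => ?_
        rw [← lintegral_mul_const _ (by fun_prop)]
        refine lintegral_congr fun y => ?_
        rw [← lintegral_const_mul _ (by fun_prop)]
        refine lintegral_congr fun z => ?_
        ring
    _ = ∫⁻ y, ∫⁻ z, (∑ i ∈ s, φ₁ i y * φ₂ i z) * (g₁ y * g₂ z) ∂μ ∂μ := by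
        rw [← lintegral_finsetSum' s fun i _ => ?_]
        · refine lintegral_congr fun y => ?_
          rw [← lintegral_finsetSum _ fun i _ => by fun_prop]
          simp only [Finset.sum_mul]
        · refine Measurable.aemeasurable ?_
          have : ∀ y, ∫⁻ z, φ₁ i y * φ₂ i z * (g₁ y * g₂ z) ∂μ =
              φ₁ i y * g₁ y * ∫⁻ z, φ₂ i z * g₂ z ∂μ := fun y => by
            rw [← lintegral_const_mul _ (by fun_prop)]
            refine lintegral_congr fun z => ?_
            ring
          simp only [this]
          fun_prop
    _ ≤ ∫⁻ y, ∫⁻ z, C * (g₁ y * g₂ z) ∂μ ∂μ := by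
        gcongr with y z
        exact h y z
    _ = _ := by
        rw [mul_assoc, ← lintegral_mul_const _ hg₁, ← lintegral_const_mul _ (by fun_prop)]
        refine lintegral_congr fun y => ?_
        rw [← lintegral_const_mul _ hg₂, ← lintegral_const_mul _ (by fun_prop)]

/-- Minkowski's inequality for finitely many functions on a finite set. -/
theorem sum_sum_rpow_le {ι κ : Type*} (s : Finset ι) (t : Finset κ) {r : ℝ} (hr : 1 ≤ r)
    {x : ι → κ → ℝ} (hx : ∀ i d, 0 ≤ x i d) :
    (∑ d ∈ t, (∑ i ∈ s, x i d) ^ r) ^ (1 / r) ≤ ∑ i ∈ s, (∑ d ∈ t, x i d ^ r) ^ (1 / r) := by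
  have hr0 : 0 < r := by linarith
  classical
  induction s using Finset.induction_on with
  | empty => simp [Real.zero_rpow hr0.ne', hr0.ne']
  | insert i s hi ih =>
    simp only [Finset.sum_insert hi]
    refine (Real.Lp_add_le_of_nonneg t hr (fun d _ => hx i d)
      (fun d _ => Finset.sum_nonneg fun i _ => hx i d)).trans ?_
    gcongr

/-- Each hypothesis bounds an `ℓ^r` norm over `t` by `K ^ (1 / r) * B i`; the triangle inequality
adds these without changing `K`. -/
theorem sum_sum_rpow_le_of_le {ι κ : Type*} (s : Finset ι) (t : Finset κ) {r K : ℝ} (hr : 1 ≤ r)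
    (hK : 0 ≤ K) {x : ι → κ → ℝ} (hx : ∀ i d, 0 ≤ x i d) {B : ι → ℝ} (hB : ∀ i, 0 ≤ B i)
    (h : ∀ i ∈ s, ∑ d ∈ t, x i d ^ r ≤ K * B i ^ r) :
    ∑ d ∈ t, (∑ i ∈ s, x i d) ^ r ≤ K * (∑ i ∈ s, B i) ^ r := by
  have hr0 : 0 < r := by linarith
  have hS : 0 ≤ ∑ d ∈ t, (∑ i ∈ s, x i d) ^ r :=
    Finset.sum_nonneg fun d _ => Real.rpow_nonneg (Finset.sum_nonneg fun i _ => hx i d) _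
  have key : (∑ d ∈ t, (∑ i ∈ s, x i d) ^ r) ^ (1 / r) ≤ K ^ (1 / r) * ∑ i ∈ s, B i := by
    refine (sum_sum_rpow_le s t hr hx).trans ?_
    rw [Finset.mul_sum]
    refine Finset.sum_le_sum fun i hi => ?_
    calc _ ≤ (K * B i ^ r) ^ (1 / r) :=
          Real.rpow_le_rpow (Finset.sum_nonneg fun d _ => Real.rpow_nonneg (hx i d) _) (h i hi)
            (by positivity)
      _ = _ := by
          rw [Real.mul_rpow hK (Real.rpow_nonneg (hB i) _), ← Real.rpow_mul (hB i),
            mul_one_div_cancel hr0.ne', Real.rpow_one]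
  have := Real.rpow_le_rpow (Real.rpow_nonneg hS _) key hr0.le
  rwa [← Real.rpow_mul hS, one_div_mul_cancel hr0.ne', Real.rpow_one,
    Real.mul_rpow (Real.rpow_nonneg hK _) (Finset.sum_nonneg fun i _ => hB i),
    ← Real.rpow_mul hK, one_div_mul_cancel hr0.ne', Real.rpow_one] at this

/-! ### Fourier projections of a function with spectrum near the parabola -/

theorem measurableSet_strip {J : Set ℝ} (hJ : MeasurableSet J) :
    MeasurableSet {ξ : Plane | ξ 0 ∈ J} :=
  hJ.preimage (f := fun ξ : Plane => ξ 0) (by fun_prop)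

/-- On a bounded set the polynomial weight is bounded below. Integrability of `Fhat` makes every
projection a bounded continuous function given by a genuine Fourier integral. -/
theorem integrable_of_isTempered_of_support {Fhat : Plane → ℂ} (h : IsTempered Fhat) {r : ℝ}
    (hr : 0 ≤ r) (hsupp : ∀ᵐ ξ, r < ‖ξ‖ → Fhat ξ = 0) : Integrable Fhat := by
  obtain ⟨N, hN⟩ := h
  have hm : AEStronglyMeasurable Fhat volume := by
    have hc : Continuous fun x : Plane => (1 + ‖x‖) ^ N := by fun_prop
    refine (hc.aestronglyMeasurable.smul hN.aestronglyMeasurable).congr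
      (Filter.Eventually.of_forall fun x => ?_)
    simp only [Pi.smul_apply']
    rw [smul_smul, mul_inv_cancel₀ (by positivity), one_smul]
  refine (hN.norm.const_mul ((1 + r) ^ N)).mono' hm ?_
  filter_upwards [hsupp] with x hx
  by_cases h0 : Fhat x = 0
  · rw [h0, norm_zero]; positivity
  have hxr : ‖x‖ ≤ r := not_lt.mp fun h => h0 (hx h)
  rw [norm_smul, norm_inv, Real.norm_of_nonneg (by positivity), ← mul_assoc, ← div_eq_mul_inv]
  refine le_mul_of_one_le_left (norm_nonneg _) ?_
  rw [one_le_div (by positivity)]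
  gcongr

theorem norm_le_of_mem_parabolaNhd {δ : ℝ} (hδ1 : δ ≤ 1) {ξ : Plane}
    (h : ξ ∈ parabolaNhd δ) : ‖ξ‖ ≤ 3 := by
  obtain ⟨⟨h0, h1⟩, t, ⟨ht0, ht1⟩, e⟩ := h
  refine (Plane.norm_le_abs_add_abs ξ).trans ?_
  rw [e, abs_of_nonneg h0, abs_of_nonneg (by positivity)]
  nlinarith

section FourierProj

variable {Fhat : Plane → ℂ} {J : Set ℝ}

theorem continuous_fourierProj (h : Integrable Fhat) (hJ : MeasurableSet J) :
    Continuous (fourierProj Fhat J) :=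
  continuous_fourierInv (h.indicator (measurableSet_strip hJ))

theorem norm_fourierProj_le (h : Integrable Fhat) (J : Set ℝ) (x : Plane) :
    ‖fourierProj Fhat J x‖ ≤ ∫ v, ‖Fhat v‖ := by
  refine (norm_fourierInv_le_integral_norm _ x).trans ?_
  refine integral_mono_of_nonneg (Filter.Eventually.of_forall fun _ => norm_nonneg _) h.norm
    (Filter.Eventually.of_forall fun v => ?_)
  exact norm_indicator_le_norm_self _ _

theorem integrable_fourierProj_rpow_mul_weight (h : Integrable Fhat) (hJ : MeasurableSet J)
    {q : ℝ} (hq : 0 ≤ q) (c : Plane) {R : ℝ} (hR : 0 < R) :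
    Integrable fun x => ‖fourierProj Fhat J x‖ ^ q * weight c R x := by
  refine (integrable_weight c hR).bdd_mul (c := (∫ v, ‖Fhat v‖) ^ q) ?_ ?_
  · exact ((continuous_fourierProj h hJ).norm.rpow_const fun _ => Or.inr hq).aestronglyMeasurable
  · refine Filter.Eventually.of_forall fun x => ?_
    rw [Real.norm_of_nonneg (Real.rpow_nonneg (norm_nonneg _) _)]
    exact Real.rpow_le_rpow (norm_nonneg _) (norm_fourierProj_le h J x) hq

theorem lintegral_fourierProj_rpow_mul_weight (h : Integrable Fhat) (hJ : MeasurableSet J)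
    {q : ℝ} (hq : 0 ≤ q) (c : Plane) {R : ℝ} (hR : 0 < R) :
    ∫⁻ x, ‖fourierProj Fhat J x‖ₑ ^ q * ENNReal.ofReal (weight c R x) =
      ENNReal.ofReal (∫ x, ‖fourierProj Fhat J x‖ ^ q * weight c R x) := by
  rw [ofReal_integral_eq_lintegral_ofReal
    (integrable_fourierProj_rpow_mul_weight h hJ hq c hR)]
  · refine lintegral_congr fun x => ?_
    rw [ENNReal.ofReal_mul (Real.rpow_nonneg (norm_nonneg _) _),
      ← ENNReal.ofReal_rpow_of_nonneg (norm_nonneg _) hq, ofReal_norm]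
  · exact Filter.Eventually.of_forall fun x =>
      mul_nonneg (Real.rpow_nonneg (norm_nonneg _) _) (weight_nonneg hR.le x)

theorem integral_rpow_mul_weight_nonneg (f : Plane → ℂ) (q : ℝ) (c : Plane) {R : ℝ} (hR : 0 ≤ R) :
    0 ≤ ∫ x, ‖f x‖ ^ q * weight c R x :=
  integral_nonneg fun x => mul_nonneg (Real.rpow_nonneg (norm_nonneg _) _) (weight_nonneg hR x)

end FourierProj

theorem avgNorm_nonneg (q : ℝ) (c : Plane) {R : ℝ} (hR : 0 ≤ R) (f : Plane → ℂ) :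
    0 ≤ avgNorm q c R f :=
  Real.rpow_nonneg (mul_nonneg (by positivity) (integral_rpow_mul_weight_nonneg f q c hR)) _

theorem avgNorm_rpow {q : ℝ} (hq : 0 < q) (c : Plane) {R : ℝ} (hR : 0 ≤ R) (f : Plane → ℂ) :
    avgNorm q c R f ^ q = 1 / R ^ 2 * ∫ x, ‖f x‖ ^ q * weight c R x := by
  unfold avgNorm
  rw [← Real.rpow_mul (mul_nonneg (by positivity) (integral_rpow_mul_weight_nonneg f q c hR)),
    one_div_mul_cancel hq.ne', Real.rpow_one]

/-- The weighted `L^q` mass on a `δ⁻¹`-square of a function with spectrum over an interval of length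
`δ` is controlled by its mass on a tube of width `δ⁻¹` and length `δ⁻²` through the square. -/
theorem exists_lintegral_fourierProj_le {q : ℝ} (hq : 1 < q) :
    ∃ C : ℝ, 0 < C ∧ ∀ δ a : ℝ, 0 < δ → δ ≤ 1 → 0 ≤ a → a ≤ 1 → ∀ Fhat : Plane → ℂ,
      Integrable Fhat → (∀ᵐ ξ, ξ ∉ parabolaNhd (δ ^ 2) → Fhat ξ = 0) → ∀ c : Plane,
      ∫⁻ x, ‖fourierProj Fhat (Set.Icc a (a + δ)) x‖ₑ ^ q * ENNReal.ofReal (weight c δ⁻¹ x) ≤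
        ∫⁻ x, ‖fourierProj Fhat (Set.Icc a (a + δ)) x‖ₑ ^ q *
          ENNReal.ofReal (C * δ * weight c (δ⁻¹ ^ 2) x *
            (decay (δ * acrossTube a (x - c)) + δ)) := by
  obtain ⟨ψ, hψ⟩ := exists_schwartz_fourier_eq_one
  obtain ⟨C, hC, hT⟩ := exists_lintegral_weight_tube_le ψ
  have hq0 : 0 ≤ q - 1 := by linarith
  set K : ℝ := (∫ y, ‖ψ y‖) ^ (q - 1) with hK
  have hI0 : 0 ≤ ∫ y, ‖ψ y‖ := integral_nonneg fun _ => norm_nonneg _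
  have hK0 : 0 ≤ K := Real.rpow_nonneg hI0 _
  have hKe : (∫⁻ y, ‖ψ y‖ₑ) ^ (q - 1) = ENNReal.ofReal K := by
    rw [hK, ← ENNReal.ofReal_rpow_of_nonneg hI0 hq0,
      ofReal_integral_norm_eq_lintegral_enorm ψ.integrable]
  -- `K` is only known to be nonnegative; `K + 1` keeps the constant positive.
  refine ⟨(K + 1) * C, by positivity, fun δ a hδ hδ1 ha ha1 Fhat hF hsupp c => ?_⟩
  have hJ : MeasurableSet (Set.Icc a (a + δ)) := measurableSet_Icc
  have hδi : 0 ≤ δ⁻¹ := by positivity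
  have hrep := enorm_fourierInv_le_lintegral_translate
    (hF.indicator (measurableSet_strip hJ)) ψ (stripMap δ a) (tubeMap δ a) (inner_tubeMap δ a)
    !₂[a, a ^ 2] (by
      filter_upwards [hsupp] with ξ hξ h0
      have hmem : ξ ∈ {ξ : Plane | ξ 0 ∈ Set.Icc a (a + δ)} := Set.mem_of_indicator_ne_zero h0
      rw [Set.indicator_of_mem hmem] at h0
      exact hψ _ (norm_stripMap_le hδ hmem (not_not.mp fun h => h0 (hξ h))))
  have hf : Measurable fun x => ‖fourierProj Fhat (Set.Icc a (a + δ)) x‖ₑ :=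
    (continuous_fourierProj hF hJ).measurable.enorm
  refine (lintegral_rpow_mul_le hq hf
    (continuous_weight c hδi).measurable.ennreal_ofReal
    ψ.continuous.measurable.enorm (tubeMap δ a).continuous.measurable hrep).trans ?_
  rw [hKe, ← lintegral_const_mul']
  swap
  · exact ENNReal.ofReal_ne_top
  refine lintegral_mono fun x => ?_
  have hW : 0 ≤ weight c (δ⁻¹ ^ 2) x := weight_nonneg (by positivity) _
  have hD := decay_pos (δ * acrossTube a (x - c))
  calc _ ≤ ENNReal.ofReal K * (‖fourierProj Fhat (Set.Icc a (a + δ)) x‖ₑ ^ q *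
          ENNReal.ofReal (C * δ * weight c (δ⁻¹ ^ 2) x *
            (decay (δ * acrossTube a (x - c)) + δ))) := by
        gcongr
        exact hT δ a hδ hδ1 ha ha1 c x
    _ = ‖fourierProj Fhat (Set.Icc a (a + δ)) x‖ₑ ^ q * ENNReal.ofReal (K * (C * δ *
          weight c (δ⁻¹ ^ 2) x * (decay (δ * acrossTube a (x - c)) + δ))) := by
        rw [ENNReal.ofReal_mul hK0]
        ring
    _ ≤ _ := by
        refine mul_le_mul' le_rfl (ENNReal.ofReal_le_ofReal ?_)
        have : 0 ≤ C * δ * weight c (δ⁻¹ ^ 2) x * (decay (δ * acrossTube a (x - c)) + δ) := by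
          positivity
        linarith

/-! ### The squares of the partition -/

theorem norm_subCenter_sub_le {R : ℝ} (hR : 0 < R) (c : Plane) {N m n : ℕ} (hm : m < N)
    (hn : n < N) : ‖subCenter c R N m n - c‖ ≤ R := by
  have hN : (0 : ℝ) < N := by exact_mod_cast (Nat.zero_le m).trans_lt hm
  have key : ∀ l : ℕ, l < N → |((l : ℝ) + 1 / 2) * (R / N) - R / 2| ≤ R / 2 := by
    intro l hl
    have h1 : ((l : ℝ) + 1 / 2) * (R / N) ≤ N * (R / N) := by
      gcongr
      have : (l : ℝ) + 1 ≤ N := by exact_mod_cast hl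
      linarith
    rw [mul_div_cancel₀ _ hN.ne'] at h1
    have h0 : 0 ≤ ((l : ℝ) + 1 / 2) * (R / N) := by positivity
    rw [abs_le]
    constructor <;> linarith
  refine (Plane.norm_le_abs_add_abs _).trans ?_
  have e0 : (subCenter c R N m n - c) 0 = ((m : ℝ) + 1 / 2) * (R / N) - R / 2 := by
    simp only [subCenter, PiLp.sub_apply, Matrix.cons_val_zero]
    ring
  have e1 : (subCenter c R N m n - c) 1 = ((n : ℝ) + 1 / 2) * (R / N) - R / 2 := by
    simp only [subCenter, PiLp.sub_apply, Matrix.cons_val_one,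
      Matrix.cons_val_zero]
    ring
  rw [e0, e1]
  linarith [key m hm, key n hn]

/-- In units of the tube width, square `(m, n)` sits at `m + 2 * a * n`, which brings the tube
weights into the form of the counting lemma. The constant offset comes from measuring from the
center of the big square. -/
theorem acrossTube_sub_subCenter {δ : ℝ} (hδ : 0 < δ) {N : ℕ} (hN : δ * N = 1) (a : ℝ)
    (c x : Plane) (m n : ℕ) :
    δ * acrossTube a (x - subCenter c (δ⁻¹ ^ 2) N m n) =
      δ * acrossTube a (x - c) + (N - 1) * (1 + 2 * a) / 2 - m - 2 * a * n := by
  have hN' : (N : ℝ) = δ⁻¹ := (eq_inv_of_mul_eq_one_right hN)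
  simp only [acrossTube, subCenter, PiLp.sub_apply, Matrix.cons_val_zero,
    Matrix.cons_val_one]
  rw [hN']
  field_simp
  ring

/-- Bilinear estimate for two transversal frequency strips. -/
theorem exists_sum_avgNorm_mul_avgNorm_le {q : ℝ} (hq : 1 < q) {c₀ : ℝ} (hc₀ : 0 < c₀) :
    ∃ C : ℝ, 0 < C ∧ ∀ (N : ℕ) (δ a b : ℝ), 0 < δ → δ * N = 1 → 0 ≤ a → a ≤ 1 → 0 ≤ b → b ≤ 1 →
      c₀ ≤ |a - b| → ∀ Fhat : Plane → ℂ, Integrable Fhat →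
      (∀ᵐ ξ, ξ ∉ parabolaNhd (δ ^ 2) → Fhat ξ = 0) → ∀ c : Plane,
      ∑ d ∈ Finset.range N ×ˢ Finset.range N,
        avgNorm q (subCenter c (δ⁻¹ ^ 2) N d.1 d.2) δ⁻¹
            (fourierProj Fhat (Set.Icc a (a + δ))) ^ q *
          avgNorm q (subCenter c (δ⁻¹ ^ 2) N d.1 d.2) δ⁻¹
            (fourierProj Fhat (Set.Icc b (b + δ))) ^ q ≤
        C * (N : ℝ) ^ 2 * (avgNorm q c (δ⁻¹ ^ 2) (fourierProj Fhat (Set.Icc a (a + δ))) ^ q *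
          avgNorm q c (δ⁻¹ ^ 2) (fourierProj Fhat (Set.Icc b (b + δ))) ^ q) := by
  obtain ⟨K, hK, hloc⟩ := exists_lintegral_fourierProj_le hq
  obtain ⟨M, hM, hcount⟩ := exists_sum_decay_mul_decay_le hc₀
  set P : ℝ := K * 2 ^ 200 with hP
  have hP0 : 0 < P := by positivity
  clear_value P
  refine ⟨P ^ 2 * M, by positivity,
    fun N δ a b hδ hN ha ha1 hb hb1 hab Fhat hF hsupp c => ?_⟩
  have hq0 : 0 < q := by linarith
  have hN0 : 0 < N := by
    rcases Nat.eq_zero_or_pos N with h | h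
    · simp [h] at hN
    · exact h
  have hN' : (N : ℝ) = δ⁻¹ := (eq_inv_of_mul_eq_one_right hN)
  have hδ1 : δ ≤ 1 := by
    have : (1 : ℝ) ≤ N := by exact_mod_cast hN0
    nlinarith
  have hδi : 0 < δ⁻¹ := by positivity
  have hδi2 : 0 < δ⁻¹ ^ 2 := by positivity
  set S := Finset.range N ×ˢ Finset.range N with hS
  set G : ℝ → Plane → ℝ → ℝ := fun a c R =>
    ∫ x, ‖fourierProj Fhat (Set.Icc a (a + δ)) x‖ ^ q * weight c R x with hG
  have hG0 : ∀ a c R, 0 ≤ R → 0 ≤ G a c R := fun a c R hR =>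
    integral_rpow_mul_weight_nonneg _ q c hR
  set φ : ℝ → ℕ × ℕ → Plane → ℝ := fun a d x =>
    decay (δ * acrossTube a (x - c) + (N - 1) * (1 + 2 * a) / 2 - d.1 - 2 * a * d.2) + δ with hφ
  have hφ0 : ∀ a d x, 0 ≤ φ a d x := fun a d x => add_nonneg (decay_pos _).le hδ.le
  have hφm : ∀ a d, Measurable fun x => ENNReal.ofReal (P * δ * φ a d x) := by
    intro a d
    have : Continuous fun x => P * δ * φ a d x := by
      simp only [hφ, acrossTube]
      exact continuous_const.mul ((continuous_decay.comp (by fun_prop)).add continuous_const)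
    exact this.measurable.ennreal_ofReal
  have hgm : ∀ a, Measurable fun x => ‖fourierProj Fhat (Set.Icc a (a + δ)) x‖ₑ ^ q *
      ENNReal.ofReal (weight c (δ⁻¹ ^ 2) x) := fun a =>
    ((continuous_fourierProj hF measurableSet_Icc).measurable.enorm.pow_const q).mul
      (continuous_weight c hδi2.le).measurable.ennreal_ofReal
  have hsq : ∀ a, 0 ≤ a → a ≤ 1 → ∀ d ∈ S,
      ENNReal.ofReal (G a (subCenter c (δ⁻¹ ^ 2) N d.1 d.2) δ⁻¹) ≤
        ∫⁻ x, ENNReal.ofReal (P * δ * φ a d x) *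
          (‖fourierProj Fhat (Set.Icc a (a + δ)) x‖ₑ ^ q *
            ENNReal.ofReal (weight c (δ⁻¹ ^ 2) x)) := by
    -- The coarse weight centered at the small square is replaced by the one centered at `c`, at the
    -- cost of the factor `2 ^ 200` in `P`.
    intro a ha ha1 d hd
    rw [hS, Finset.mem_product, Finset.mem_range, Finset.mem_range] at hd
    rw [hG, ← lintegral_fourierProj_rpow_mul_weight hF measurableSet_Icc hq0.le _ hδi]
    refine (hloc δ a hδ hδ1 ha ha1 Fhat hF hsupp _).trans ?_
    refine lintegral_mono fun x => ?_
    rw [acrossTube_sub_subCenter hδ hN, mul_left_comm,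
      ← ENNReal.ofReal_mul (mul_nonneg (by positivity) (hφ0 a d x))]
    refine mul_le_mul' le_rfl (ENNReal.ofReal_le_ofReal ?_)
    have hw := weight_le_of_norm_sub_le hδi2 (norm_subCenter_sub_le hδi2 c hd.1 hd.2) x
    calc _ ≤ K * δ * (2 ^ 200 * weight c (δ⁻¹ ^ 2) x) * φ a d x :=
          mul_le_mul_of_nonneg_right (mul_le_mul_of_nonneg_left hw (by positivity)) (hφ0 a d x)
      _ = _ := by
          rw [hP]
          generalize (2 : ℝ) ^ 200 = p
          ring
  have hsumφ : ∀ y z, ∑ d ∈ S, ENNReal.ofReal (P * δ * φ a d y) *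
      ENNReal.ofReal (P * δ * φ b d z) ≤ ENNReal.ofReal ((P * δ) ^ 2 * M) := by
    intro y z
    have h := hcount N δ a b hδ hN hab (δ * acrossTube a (y - c) + (N - 1) * (1 + 2 * a) / 2)
      (δ * acrossTube b (z - c) + (N - 1) * (1 + 2 * b) / 2)
    rw [← Finset.sum_product'] at h
    have hnn : ∀ a d x, 0 ≤ P * δ * φ a d x := fun a d x => mul_nonneg (by positivity) (hφ0 a d x)
    calc _ = ENNReal.ofReal (∑ d ∈ S, P * δ * φ a d y * (P * δ * φ b d z)) := by
          rw [ENNReal.ofReal_sum_of_nonneg fun d _ => mul_nonneg (hnn a d y) (hnn b d z)]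
          exact Finset.sum_congr rfl fun d _ => (ENNReal.ofReal_mul (hnn a d y)).symm
      _ ≤ _ := by
          refine ENNReal.ofReal_le_ofReal ?_
          calc _ = (P * δ) ^ 2 * ∑ d ∈ S, φ a d y * φ b d z := by
                rw [Finset.mul_sum]
                exact Finset.sum_congr rfl fun d _ => by ring
            _ ≤ _ := mul_le_mul_of_nonneg_left h (by positivity)
  have key : ∑ d ∈ S, G a (subCenter c (δ⁻¹ ^ 2) N d.1 d.2) δ⁻¹ *
      G b (subCenter c (δ⁻¹ ^ 2) N d.1 d.2) δ⁻¹ ≤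
        (P * δ) ^ 2 * M * (G a c (δ⁻¹ ^ 2) * G b c (δ⁻¹ ^ 2)) := by
    have hnn : ∀ a (d : ℕ × ℕ), 0 ≤ G a (subCenter c (δ⁻¹ ^ 2) N d.1 d.2) δ⁻¹ := fun a d =>
      hG0 a _ _ hδi.le
    rw [← ENNReal.ofReal_le_ofReal_iff
      (mul_nonneg (by positivity) (mul_nonneg (hG0 a c _ hδi2.le) (hG0 b c _ hδi2.le))),
      ENNReal.ofReal_sum_of_nonneg fun d _ => mul_nonneg (hnn a d) (hnn b d)]
    have h := sum_lintegral_mul_lintegral_le (μ := volume) S (hgm a) (hgm b) (hφm a) (hφm b) hsumφ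
    rw [lintegral_fourierProj_rpow_mul_weight hF measurableSet_Icc hq0.le c hδi2,
      lintegral_fourierProj_rpow_mul_weight hF measurableSet_Icc hq0.le c hδi2,
      ← ENNReal.ofReal_mul (by positivity), ← ENNReal.ofReal_mul
        (mul_nonneg (by positivity) (hG0 a c _ hδi2.le)), mul_assoc _ (∫ x, _)] at h
    refine le_trans (Finset.sum_le_sum fun d hd => ?_) h
    rw [ENNReal.ofReal_mul (hnn a d)]
    exact mul_le_mul' (hsq a ha ha1 d hd) (hsq b hb hb1 d hd)
  simp only [avgNorm_rpow hq0 _ hδi.le, avgNorm_rpow hq0 _ hδi2.le]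
  -- Normalization: the small squares give `δ ^ 4` and the tube weights `δ ^ 2`, against `δ ^ 8`
  -- from the two averages over the big square; the quotient `δ⁻¹ ^ 2` is the number `N ^ 2` of
  -- squares.
  calc _ = δ ^ 4 * ∑ d ∈ S, G a (subCenter c (δ⁻¹ ^ 2) N d.1 d.2) δ⁻¹ *
        G b (subCenter c (δ⁻¹ ^ 2) N d.1 d.2) δ⁻¹ := by
        rw [Finset.mul_sum]
        refine Finset.sum_congr rfl fun d _ => ?_
        rw [mul_mul_mul_comm]
        congr 1
        field_simp
    _ ≤ δ ^ 4 * ((P * δ) ^ 2 * M * (G a c (δ⁻¹ ^ 2) * G b c (δ⁻¹ ^ 2))) := by gcongr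
    _ = P ^ 2 * M * (N : ℝ) ^ 2 * ((1 / (δ⁻¹ ^ 2) ^ 2 * G a c (δ⁻¹ ^ 2)) *
          (1 / (δ⁻¹ ^ 2) ^ 2 * G b c (δ⁻¹ ^ 2))) := by
        rw [hN', mul_mul_mul_comm (1 / (δ⁻¹ ^ 2) ^ 2)]
        generalize G a c (δ⁻¹ ^ 2) * G b c (δ⁻¹ ^ 2) = g
        field_simp

/-! ### Ball inflation -/

theorem dyadicInterval_eq_Icc {k : ℕ} {δ : ℝ} (hδ : δ = (1 / 2) ^ k) (j : ℕ) :
    dyadicInterval k j = Set.Icc (j * δ) (j * δ + δ) := by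
  rw [dyadicInterval, hδ, one_div, inv_pow, ← div_eq_mul_inv, add_div, one_div]

theorem mem_of_mem_part {k : ℕ} {δ : ℝ} (hδ : δ = (1 / 2) ^ k) {I : Set ℝ} {j : ℕ}
    (hj : j ∈ part k I) : (j * δ : ℝ) ∈ I ∧ (0 : ℝ) ≤ j * δ ∧ (j * δ : ℝ) ≤ 1 := by
  classical
  rw [part, Finset.mem_filter, Finset.mem_range] at hj
  have hδ0 : 0 < δ := by rw [hδ]; positivity
  refine ⟨hj.2 ?_, by positivity, ?_⟩
  · rw [dyadicInterval_eq_Icc hδ]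
    exact ⟨le_rfl, by linarith⟩
  · rw [hδ, one_div, inv_pow, ← div_eq_mul_inv, div_le_one (by positivity)]
    exact_mod_cast hj.1.le

/-- The exponents multiply to `2q / 4 = q / 2`, and the product of the two sums becomes one sum over
pairs, ready for Minkowski's inequality. -/
theorem bilinear_rpow {q : ℝ} (k : ℕ) (I₁ I₂ : Set ℝ) (Fhat : Plane → ℂ) (c : Plane) (R : ℝ) :
    bilinear q k I₁ I₂ Fhat c R ^ (2 * q) =
      (∑ i ∈ part k I₁ ×ˢ part k I₂,
        avgNorm q c R (fourierProj Fhat (dyadicInterval k i.1)) ^ 2 *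
          avgNorm q c R (fourierProj Fhat (dyadicInterval k i.2)) ^ 2) ^ (q / 2) := by
  have h : ∀ I, 0 ≤ ∑ j ∈ part k I,
      avgNorm q c R (fourierProj Fhat (dyadicInterval k j)) ^ 2 := fun I =>
    Finset.sum_nonneg fun j _ => sq_nonneg _
  rw [bilinear, ← Real.mul_rpow (h _) (h _), ← Real.rpow_mul (mul_nonneg (h _) (h _)),
    Finset.sum_mul_sum, ← Finset.sum_product']
  congr 1
  ring

end BallInflation
end

/-! ### From pairs of strips to the full bilinear inequality. -/

theorem mainTheorem5 (p q : ℝ) (hq : 2 ≤ q) (hpq : p = 2 * q) (c₀ : ℝ) (hc₀ : 0 < c₀)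
    (ε : ℝ) (hε : 0 < ε) :
    ∃ C : ℝ, 0 < C ∧
      ∀ (k : ℕ) (δ : ℝ), 1 ≤ k → δ = (1 / 2) ^ k →
      ∀ I₁ I₂ : Set ℝ,
        BallInflation.IsDyadicAtLeast k I₁ → BallInflation.IsDyadicAtLeast k I₂ →
        (∀ x ∈ I₁, ∀ y ∈ I₂, c₀ ≤ dist x y) →
      ∀ (c : BallInflation.Plane) (F Fhat : BallInflation.Plane → ℂ),
        BallInflation.HasFourierTransform F Fhat →
        (∀ᵐ ξ, ξ ∉ BallInflation.parabolaNhd (δ ^ 2) → Fhat ξ = 0) →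
        1 / ((2 : ℝ) ^ k) ^ 2 *
            ∑ m ∈ Finset.range (2 ^ k), ∑ n ∈ Finset.range (2 ^ k),
              BallInflation.bilinear q k I₁ I₂ Fhat
                (BallInflation.subCenter c (δ⁻¹ ^ 2) (2 ^ k) m n) δ⁻¹ ^ p
          ≤ C * δ ^ (-ε) * BallInflation.bilinear q k I₁ I₂ Fhat c (δ⁻¹ ^ 2) ^ p := by
  obtain ⟨C, hC, hpair⟩ :=
    BallInflation.exists_sum_avgNorm_mul_avgNorm_le (by linarith : 1 < q) hc₀
  refine ⟨C, hC, fun k δ _ hδ I₁ I₂ _ _ hdist c F Fhat hF hsupp => ?_⟩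
  have hq0 : 0 < q := by linarith
  have hδ0 : 0 < δ := by rw [hδ]; positivity
  have hδ1 : δ ≤ 1 := by rw [hδ]; exact pow_le_one₀ (by norm_num) (by norm_num)
  have hN : δ * ((2 ^ k : ℕ) : ℝ) = 1 := by
    rw [hδ]; push_cast; rw [← mul_pow]; norm_num
  have hint : Integrable Fhat := by
    refine BallInflation.integrable_of_isTempered_of_support hF.tempered_hat
      (by norm_num : (0 : ℝ) ≤ 3) ?_
    filter_upwards [hsupp] with ξ hξ h3
    exact hξ fun hmem =>
      (BallInflation.norm_le_of_mem_parabolaNhd (pow_le_one₀ hδ0.le hδ1) hmem).not_gt h3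
  have hav : ∀ c R (f : BallInflation.Plane → ℂ), 0 ≤ R →
      0 ≤ BallInflation.avgNorm q c R f := fun c R f hR => BallInflation.avgNorm_nonneg q c hR f
  have hrp : ∀ x y : ℝ, 0 ≤ x → 0 ≤ y → (x ^ 2 * y ^ 2) ^ (q / 2) = x ^ q * y ^ q := by
    intro x y hx hy
    rw [Real.mul_rpow (sq_nonneg _) (sq_nonneg _), ← Real.rpow_natCast_mul hx,
      ← Real.rpow_natCast_mul hy]
    norm_num [mul_div_cancel₀]
  have hδi : 0 ≤ δ⁻¹ := by positivity
  have hδi2 : 0 ≤ δ⁻¹ ^ 2 := by positivity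
  have hmain : ∑ m ∈ Finset.range (2 ^ k), ∑ n ∈ Finset.range (2 ^ k),
      BallInflation.bilinear q k I₁ I₂ Fhat
        (BallInflation.subCenter c (δ⁻¹ ^ 2) (2 ^ k) m n) δ⁻¹ ^ p ≤
      C * ((2 ^ k : ℕ) : ℝ) ^ 2 * BallInflation.bilinear q k I₁ I₂ Fhat c (δ⁻¹ ^ 2) ^ p := by
    rw [← Finset.sum_product', hpq]
    simp only [BallInflation.bilinear_rpow]
    -- Minkowski with `r = q / 2`; this is where `q ≥ 2` is needed. What remains is the estimate for
    -- one pair of strips, whose left endpoints lie in `I₁`, `I₂` and are therefore `c₀`-separated.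
    refine BallInflation.sum_sum_rpow_le_of_le _ _ (by linarith) (by positivity)
      (x := fun i d => _) (fun i d => by positivity) (fun i => by positivity) fun i hi => ?_
    rw [Finset.mem_product] at hi
    obtain ⟨h1, h1a, h1b⟩ := BallInflation.mem_of_mem_part hδ hi.1
    obtain ⟨h2, h2a, h2b⟩ := BallInflation.mem_of_mem_part hδ hi.2
    rw [hrp _ _ (hav _ _ _ hδi2) (hav _ _ _ hδi2)]
    simp only [hrp _ _ (hav _ _ _ hδi) (hav _ _ _ hδi), BallInflation.dyadicInterval_eq_Icc hδ]
    exact hpair (2 ^ k) δ _ _ hδ0 hN h1a h1b h2a h2b (hdist _ h1 _ h2) Fhat hint hsupp c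
  have hB : 0 ≤ BallInflation.bilinear q k I₁ I₂ Fhat c (δ⁻¹ ^ 2) ^ p :=
    Real.rpow_nonneg (mul_nonneg
      (Real.rpow_nonneg (Finset.sum_nonneg fun _ _ => sq_nonneg _) _)
      (Real.rpow_nonneg (Finset.sum_nonneg fun _ _ => sq_nonneg _) _)) _
  -- The estimate is already free of loss, so the factor `δ ^ (-ε)` is simply inserted at the end.
  have hone : 1 ≤ δ ^ (-ε) := Real.one_le_rpow_of_pos_of_le_one_of_nonpos hδ0 hδ1 (by linarith)
  calc _ ≤ 1 / ((2 : ℝ) ^ k) ^ 2 * (C * ((2 ^ k : ℕ) : ℝ) ^ 2 *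
        BallInflation.bilinear q k I₁ I₂ Fhat c (δ⁻¹ ^ 2) ^ p) := by gcongr
    _ = C * 1 * BallInflation.bilinear q k I₁ I₂ Fhat c (δ⁻¹ ^ 2) ^ p := by
        push_cast
        field_simp
    _ ≤ _ := by gcongr
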